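/- **Corollary (Laplace generator).** For real $\lambda$ and $u>0$ let $$K_\lambda(u)=\tfrac12\left(\tfrac u2\right)^{\lambda}\int_0^\infty t^{-\lambda-1}\exp\left(-t-\tfrac{u^2}{4t}\right)dt$$ be the modified Bessel function of the third kind. Let $\eta_1,\eta_2,\sigma_1,\sigma_2>0$ and $\rho\in(-1,1)$, write $\theta=(\eta_1,\eta_2,\sigma_1,\sigma_2,\rho)$, and for $0<w_i<1$ put $$t_i=-\log(1-w_i),\qquad \widetilde w_i=\log\left[(t_i/\eta_i)^{1/\sigma_i}\right],\qquad i=1,2 .$$ Let $g_c(x)=K_0(\sqrt{2x})$ and $Z_{g_c}=\pi\int_0^\infty g_c(u)\,du$ $(=\pi)$. Let $\boldsymbol W=(W_1,W_2)^\top\sim\mathrm{BULS}(\theta,g_c)$ be a bivariate unit-log-Laplace random vector, that is, a random vector whose joint density vanishes outside $(0,1)^2$ and equals $$f_{W_1,W_2}(w_1,w_2)=\frac{1}{(1-w_1)t_1\sigma_1\,(1-w_2)t_2\sigma_2\,\sqrt{1-\rho^2}\,Z_{g_c}}\;g_c\!\left(\frac{\widetilde w_1^{\,2}-2\rho\,\widetilde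 w_1\widetilde w_2+\widetilde w_2^{\,2}}{1-\rho^2}\right),\qquad 0<w_1,w_2<1 .$$ Let $B$ be a Borel subset of $(0,1)$ with $\mathbb P(W_2\in B)>0$, and for $-1<r<1$ (and given $w_1$) put $$B_r=\left\{\frac{1}{\sqrt{1-r^2}}\,\widetilde w_2-\frac{r}{\sqrt{1-r^2}}\,\widetilde w_1\;:\;w_2\in B\right\}.$$ Let $f_{\rm L}(x)=\exp(-\sqrt2\,|x|)/\sqrt2$ be the Laplace density with location $0$ and scale $1/\sqrt2$, and $F_{\rm L}(C)=\int_C f_{\rm L}(x)\,dx$. For $\alpha,\delta>0$ let $$f_{\rm GH}(x;\lambda,\alpha,\delta)=\frac{(\alpha/\delta)^\lambda}{\sqrt{2\pi}\,K_\lambda(\delta\alpha)}\;\frac{K_{\lambda-1/2}\big(\alpha\sqrt{\delta^2+x^2}\big)}{\big(\sqrt{\delta^2+x^2}/\alpha\big)^{1/2-\lambda}},\qquad F_{\rm GH}(C;\lambda,\alpha,\delta)=\int_C f_{\rm GH}(x;\lambda,\alpha,\delta)\,dx ,$$ be the generalized hyperbolic density and its set function. Then the conditional law of $W_1$ given $W_2\in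 B$ has a density, which is concentrated on $(0,1)$ and is given there by $$f_{W_1}(w_1\mid W_2\in B)=\frac{1}{(1-w_1)\,t_1\,\sigma_1}\;f_{\rm L}(\widetilde w_1)\;\frac{F_{\rm GH}\big(B_\rho;\tfrac12,\sqrt2,|\widetilde w_1|\big)}{F_{\rm L}(B_0)} .$$ Moreover, for every $w_1\in(0,1)$ with $\widetilde w_1\neq0$ (that is, $w_1\ne 1-e^{-\eta_1}$; at this single point the scale parameter $|\widetilde w_1|$ of the generalized hyperbolic law is $0$, so that $F_{\rm GH}$ is not defined), the function $w_2\mapsto f_{W_1,W_2}(w_1,w_2)$ is integrable on $B$, and the right-hand side is exactly the value of the canonical version $\int_B f_{W_1,W_2}(w_1,w_2)\,dw_2\big/\mathbb P(W_2\in B)$ of the conditional density. -/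

import Mathlib

open MeasureTheory ProbabilityTheory Set
open scoped ENNReal

noncomputable section

/-- The modified Bessel function of the third kind `K_lam(u)`, for `u > 0`. -/
def besselK (lam u : ℝ) : ℝ :=
  (1 / 2) * (u / 2) ^ lam *
    ∫ t in Ioi (0 : ℝ), t ^ (-lam - 1) * Real.exp (-t - u ^ 2 / (4 * t))

/-- The density of the generalized hyperbolic law `GH(lam, α, δ)`, for `δ > 0`. -/
def ghPDF (lam α δ x : ℝ) : ℝ :=
  (√(α ^ 2) / δ) ^ lam / (√(2 * Real.pi) * besselK lam (δ * √(α ^ 2))) *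
    (besselK (lam - 1 / 2) (α * √(δ ^ 2 + x ^ 2)) /
      (√(δ ^ 2 + x ^ 2) / α) ^ (1 / 2 - lam))

/-- The set function `F_GH(C; lam, α, δ)`. -/
def ghF (C : Set ℝ) (lam α δ : ℝ) : ℝ := ∫ x in C, ghPDF lam α δ x

/-- The Laplace density with location `0` and scale `1 / √2`. -/
def laplacePDF (x : ℝ) : ℝ := Real.exp (-√2 * |x|) / √2

/-- The set function `F_L(C)`. -/
def laplaceF (C : Set ℝ) : ℝ := ∫ x in C, laplacePDF x

/-- The real function `f` is a probability density function, with respect to Lebesgue measure,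
of the random element `X` under the probability `P`. -/
def HasRealPDF {Ω E : Type*} [MeasurableSpace Ω] [MeasureSpace E]
    (X : Ω → E) (P : Measure Ω) (f : E → ℝ) : Prop :=
  HasPDF X P volume ∧ (∀ x, 0 ≤ f x) ∧
    pdf X P volume =ᵐ[volume] fun x => ENNReal.ofReal (f x)

/-- The parameter vector `θ = (η₁, η₂, σ₁, σ₂, ρ)`. -/
structure BULSParams where
  η₁ : ℝ
  η₂ : ℝ
  σ₁ : ℝ
  σ₂ : ℝ
  ρ : ℝ
  η₁_pos : 0 < η₁
  η₂_pos : 0 < η₂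
  σ₁_pos : 0 < σ₁
  σ₂_pos : 0 < σ₂
  ρ_mem : ρ ∈ Ioo (-1 : ℝ) 1

/-- `t = -log (1 - w)`. -/
def unitT (w : ℝ) : ℝ := -Real.log (1 - w)

/-- `w̃ = log [(t / η) ^ (1 / σ)]` with `t = -log (1 - w)`. -/
def unitTilde (η σ w : ℝ) : ℝ := Real.log ((unitT w / η) ^ (1 / σ))

/-- The partition function of a density generator `g`. -/
def partitionFn (g : ℝ → ℝ) : ℝ := Real.pi * ∫ u in Ioi (0 : ℝ), g u

/-- The joint density of the bivariate unit-log-symmetric law `BULS(θ, g)`; it vanishes outside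
the open unit square. -/
def bulsPDF (θ : BULSParams) (g : ℝ → ℝ) : ℝ × ℝ → ℝ :=
  (Ioo (0 : ℝ) 1 ×ˢ Ioo (0 : ℝ) 1).indicator fun w =>
    1 / ((1 - w.1) * unitT w.1 * θ.σ₁ * ((1 - w.2) * unitT w.2 * θ.σ₂) *
        √(1 - θ.ρ ^ 2) * partitionFn g) *
      g ((unitTilde θ.η₁ θ.σ₁ w.1 ^ 2
          - 2 * θ.ρ * unitTilde θ.η₁ θ.σ₁ w.1 * unitTilde θ.η₂ θ.σ₂ w.2
          + unitTilde θ.η₂ θ.σ₂ w.2 ^ 2) / (1 - θ.ρ ^ 2))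

/-- `W ∼ BULS(θ, g)` under the probability `P`. -/
def IsBULS {Ω : Type*} [MeasurableSpace Ω] (W : Ω → ℝ × ℝ) (P : Measure Ω)
    (θ : BULSParams) (g : ℝ → ℝ) : Prop :=
  HasRealPDF W P (bulsPDF θ g)

/-- The generator `x ↦ K_0(√(2 x))` of the bivariate unit-log-Laplace law. -/
def laplaceGen (x : ℝ) : ℝ := besselK 0 (√(2 * x))

/-- The set `B_r`, which depends on `w₁` through `w̃₁`. -/
def childSet (θ : BULSParams) (B : Set ℝ) (r w₁ : ℝ) : Set ℝ :=
  (fun w₂ => 1 / √(1 - r ^ 2) * unitTilde θ.η₂ θ.σ₂ w₂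
    - r / √(1 - r ^ 2) * unitTilde θ.η₁ θ.σ₁ w₁) '' B

/-- The claimed expression for the conditional density of `W₁` given `W₂ ∈ B`, for
`w₁` in `(0, 1)`. -/
def laplaceCondFormula (θ : BULSParams) (B : Set ℝ) (w₁ : ℝ) : ℝ :=
  1 / ((1 - w₁) * unitT w₁ * θ.σ₁) * laplacePDF (unitTilde θ.η₁ θ.σ₁ w₁) *
    (ghF (childSet θ B θ.ρ w₁) (1 / 2) (√2) |unitTilde θ.η₁ θ.σ₁ w₁| /
      laplaceF (childSet θ B 0 w₁))

end

/-! In the coordinates `w̃₁`, `w̃₂` the joint density becomes `g_c` of a quadratic form, and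
completing the square (`quadForm_eq`) turns that form into `a² + x²`, with `a = w̃₁` and `x = (w̃₂ -
ρ w̃₁) / √(1 - ρ²)`. As `w₂` runs over `B`, `x` runs over `B_ρ`, and the Jacobian absorbs the
remaining `w₂`-factors. The slice integral over `B` is therefore the integral of `g_c(a² + x²) / π`
over `B_ρ`. Two identities finish the proof. Pointwise, `g_c(a² + x²) / π` is the Laplace density at
`a` times the GH density at `x` (`laplacePDF_mul_ghPDF`), which gives the numerator. Integrated over
all `x`, it is the Laplace density at `a` (`lintegral_laplaceGen_sq_add`); with the coordinates
exchanged this makes `w̃₂` Laplace and gives the denominator `F_L(B_0)`. Both rest on the mixture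
integral defining `K_0` and on the evaluation of `∫ exp(-t - b²/t) / √t dt`, which also yields
`K_{1/2}`. -/

/-! ### The generator as an exponential mixture, and its normalization. -/

lemma laplaceGen_eq_integral {x : ℝ} (hx : 0 ≤ x) :
    laplaceGen x =
      ∫ t in Ioi (0 : ℝ), 1 / 2 * (t⁻¹ * Real.exp (-t - x / (2 * t))) := by
  rw [laplaceGen, besselK, Real.rpow_zero, mul_one, integral_const_mul]
  congr 1
  refine setIntegral_congr_fun measurableSet_Ioi fun t (ht : 0 < t) => ?_
  have h1 : √(2 * x) ^ 2 / (4 * t) = x / (2 * t) := by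
    rw [Real.sq_sqrt (by positivity)]
    field_simp
    ring
  simp only [h1, neg_zero, zero_sub, Real.rpow_neg_one]

lemma laplaceGen_nonneg (x : ℝ) : 0 ≤ laplaceGen x := by
  rw [laplaceGen, besselK]
  refine mul_nonneg (by positivity) (setIntegral_nonneg measurableSet_Ioi fun t (ht : 0 < t) => ?_)
  positivity

lemma integrableOn_laplaceGen_kernel {x : ℝ} (hx : 0 < x) :
    IntegrableOn (fun t : ℝ => 1 / 2 * (t⁻¹ * Real.exp (-t - x / (2 * t)))) (Ioi 0) := by
  have hexp : IntegrableOn (fun t : ℝ => (1 / x) * Real.exp (-t)) (Ioi 0) :=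
    (integrableOn_exp_neg_Ioi 0).const_mul _
  refine hexp.mono' (by fun_prop) ?_
  refine (ae_restrict_iff' measurableSet_Ioi).2 (.of_forall fun t (ht : 0 < t) => ?_)
  rw [Real.norm_of_nonneg (by positivity), sub_eq_add_neg, Real.exp_add, Real.exp_neg (x / (2 * t))]
  -- The bound `exp(-y) ≤ 1/y` at `y = x / (2t)` cancels the singular factor `t⁻¹`.
  have h : x / (2 * t) ≤ Real.exp (x / (2 * t)) := by
    linarith [Real.add_one_le_exp (x / (2 * t))]
  have h2 : (Real.exp (x / (2 * t)))⁻¹ ≤ (x / (2 * t))⁻¹ := inv_anti₀ (by positivity) h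
  calc 1 / 2 * (t⁻¹ * (Real.exp (-t) * (Real.exp (x / (2 * t)))⁻¹))
      ≤ 1 / 2 * (t⁻¹ * (Real.exp (-t) * (x / (2 * t))⁻¹)) := by gcongr
    _ = 1 / x * Real.exp (-t) := by field_simp

lemma ofReal_laplaceGen {x : ℝ} (hx : 0 < x) :
    ENNReal.ofReal (laplaceGen x) =
      ∫⁻ t in Ioi (0 : ℝ), ENNReal.ofReal (1 / 2 * (t⁻¹ * Real.exp (-t - x / (2 * t)))) := by
  rw [laplaceGen_eq_integral hx.le,
    ofReal_integral_eq_lintegral_ofReal (integrableOn_laplaceGen_kernel hx)]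
  refine (ae_restrict_iff' measurableSet_Ioi).2 (.of_forall fun t (ht : 0 < t) => ?_)
  simp only [Pi.zero_apply]
  positivity

lemma measurable_laplaceGen : Measurable laplaceGen := by
  unfold laplaceGen besselK
  have h : StronglyMeasurable fun x : ℝ => ∫ t in Ioi (0 : ℝ),
      t ^ (-(0 : ℝ) - 1) * Real.exp (-t - √(2 * x) ^ 2 / (4 * t)) := by
    refine StronglyMeasurable.integral_prod_right' (f := fun p : ℝ × ℝ =>
      p.2 ^ (-(0 : ℝ) - 1) * Real.exp (-p.2 - √(2 * p.1) ^ 2 / (4 * p.2))) ?_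
    exact Measurable.stronglyMeasurable (by fun_prop)
  have := h.measurable
  fun_prop

lemma lintegral_laplaceGen_kernel {t : ℝ} (ht : 0 < t) :
    ∫⁻ x in Ioi (0 : ℝ), ENNReal.ofReal (1 / 2 * (t⁻¹ * Real.exp (-t - x / (2 * t)))) =
      ENNReal.ofReal (Real.exp (-t)) := by
  have heq : ∀ x : ℝ, 1 / 2 * (t⁻¹ * Real.exp (-t - x / (2 * t))) =
      (1 / 2 * t⁻¹ * Real.exp (-t)) * Real.exp (-(1 / (2 * t)) * x) := fun x => by
    rw [show -t - x / (2 * t) = -t + -(1 / (2 * t)) * x by ring, Real.exp_add]; ring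
  simp_rw [heq]
  have hneg : -(1 / (2 * t)) < 0 := neg_lt_zero.2 (by positivity)
  rw [← ofReal_integral_eq_lintegral_ofReal
    ((integrableOn_exp_mul_Ioi hneg 0).const_mul _) (.of_forall fun x => by
      simp only [Pi.zero_apply]; positivity), integral_const_mul, integral_exp_mul_Ioi hneg]
  congr 1
  simp only [mul_zero, Real.exp_zero]
  field_simp

/-- By Tonelli: integrating the mixture in `x` first leaves `∫ exp(-t) dt`. -/
lemma lintegral_laplaceGen :
    ∫⁻ x in Ioi (0 : ℝ), ENNReal.ofReal (laplaceGen x) = 1 := by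
  rw [setLIntegral_congr_fun measurableSet_Ioi fun x (hx : 0 < x) => ofReal_laplaceGen hx,
    lintegral_lintegral_swap (Measurable.aemeasurable (by fun_prop)),
    setLIntegral_congr_fun measurableSet_Ioi fun t (ht : 0 < t) => lintegral_laplaceGen_kernel ht,
    ← ofReal_integral_eq_lintegral_ofReal (integrableOn_exp_neg_Ioi 0)
      (.of_forall fun x => (Real.exp_pos _).le), integral_exp_neg_Ioi_zero, ENNReal.ofReal_one]

lemma partitionFn_laplaceGen : partitionFn laplaceGen = Real.pi := by
  rw [partitionFn, integral_eq_lintegral_of_nonneg_ae (.of_forall laplaceGen_nonneg)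
    measurable_laplaceGen.aestronglyMeasurable, lintegral_laplaceGen, ENNReal.toReal_one, mul_one]

/-! ### Closed form of `K_{1/2}`. -/

lemma lintegral_exp_neg_sq :
    ∫⁻ x : ℝ, ENNReal.ofReal (Real.exp (-x ^ 2)) = ENNReal.ofReal √Real.pi := by
  have h : Integrable fun x : ℝ => Real.exp (-x ^ 2) := by
    simpa using integrable_exp_neg_mul_sq one_pos
  rw [← ofReal_integral_eq_lintegral_ofReal h (.of_forall fun x => (Real.exp_pos _).le)]
  simpa using congrArg ENNReal.ofReal (integral_gaussian 1)

/-- The involution `t ↦ b²/t` preserves the exponent `-t - b²/t`. -/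
lemma lintegral_inv_sqrt_eq {b : ℝ} (hb : 0 < b) :
    ∫⁻ t in Ioi (0 : ℝ), ENNReal.ofReal (Real.exp (-t - b ^ 2 / t) / √t) =
      ENNReal.ofReal b *
        ∫⁻ t in Ioi (0 : ℝ), ENNReal.ofReal (Real.exp (-t - b ^ 2 / t) / (t * √t)) := by
  have himg : (fun t : ℝ => b ^ 2 / t) '' Ioi 0 = Ioi 0 := by
    ext s
    constructor
    · rintro ⟨t, ht, rfl⟩
      have ht : 0 < t := ht
      exact div_pos (sq_pos_of_pos hb) ht
    · intro (hs : 0 < s)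
      exact ⟨b ^ 2 / s, div_pos (by positivity) hs, by field_simp⟩
  conv_lhs => rw [← himg]
  rw [lintegral_image_eq_lintegral_abs_deriv_mul (s := Ioi 0) (f := fun t => b ^ 2 / t)
      (f' := fun t => -(b ^ 2) / t ^ 2)
    measurableSet_Ioi (fun t (ht : 0 < t) => ?_) (fun s (hs : 0 < s) t (ht : 0 < t) h => ?_),
    ← lintegral_const_mul' _ _ ENNReal.ofReal_ne_top]
  · refine setLIntegral_congr_fun measurableSet_Ioi fun t (ht : 0 < t) => ?_
    rw [← ENNReal.ofReal_mul (abs_nonneg _), ← ENNReal.ofReal_mul hb.le]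
    congr 1
    have h1 : -(b ^ 2 / t) - b ^ 2 / (b ^ 2 / t) = -t - b ^ 2 / t := by field_simp; ring
    rw [h1, Real.sqrt_div (by positivity), Real.sqrt_sq hb.le, neg_div, abs_neg,
      abs_of_pos (by positivity)]
    have := Real.sqrt_pos.2 ht
    have h2 := Real.sq_sqrt ht.le
    field_simp
    rw [h2]
  · simp only [div_eq_mul_inv (b ^ 2)]
    refine (((hasDerivAt_inv ht.ne').const_mul (b ^ 2)).congr_deriv ?_).hasDerivWithinAt
    ring
  · simp only at h
    have hb2 : b ^ 2 ≠ 0 := by positivity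
    field_simp at h
    exact h.symm

/-- Substitute `v = √t - b/√t`, a bijection from the half-line onto the real line with `v² = t +
b²/t - 2b`; the integrand is `exp(-v²) dv/dt`. -/
lemma lintegral_add_eq_gaussian {b : ℝ} (hb : 0 < b) :
    ∫⁻ t in Ioi (0 : ℝ), ENNReal.ofReal
        (Real.exp (2 * b) / 2 * (Real.exp (-t - b ^ 2 / t) / √t +
          b * (Real.exp (-t - b ^ 2 / t) / (t * √t)))) = ENNReal.ofReal √Real.pi := by
  have himg : (fun t : ℝ => √t - b / √t) '' Ioi 0 = univ := by
    refine eq_univ_of_forall fun v => ?_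
    have hd : 0 < v ^ 2 + 4 * b := by positivity
    have hr : |v| < √(v ^ 2 + 4 * b) := by
      rw [← Real.sqrt_sq_eq_abs]
      exact Real.sqrt_lt_sqrt (sq_nonneg v) (by linarith)
    have hr2 := Real.sq_sqrt hd.le
    set r := √(v ^ 2 + 4 * b)
    have hs : 0 < (v + r) / 2 := by linarith [neg_abs_le v]
    -- `√t` is the positive root of `s² - v s - b = 0`.
    refine ⟨((v + r) / 2) ^ 2, by simpa using pow_pos hs 2, ?_⟩
    simp only [Real.sqrt_sq hs.le]
    have : v + r ≠ 0 := by linarith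
    field_simp
    nlinarith
  rw [← lintegral_exp_neg_sq, ← setLIntegral_univ fun x : ℝ => ENNReal.ofReal (Real.exp (-x ^ 2)),
    ← himg, lintegral_image_eq_lintegral_abs_deriv_mul (s := Ioi 0) (f := fun t => √t - b / √t)
      (f' := fun t => 1 / (2 * √t) + b * (1 / (2 * √t)) / (√t) ^ 2)
      measurableSet_Ioi (fun t (ht : 0 < t) => ?_) (fun s (hs : 0 < s) t (ht : 0 < t) h => ?_)]
  · refine setLIntegral_congr_fun measurableSet_Ioi fun t (ht : 0 < t) => ?_
    have h0 := Real.sqrt_pos.2 ht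
    have h2 := Real.sq_sqrt ht.le
    rw [← ENNReal.ofReal_mul (abs_nonneg _), abs_of_pos (by positivity)]
    congr 1
    have h1 : -(√t - b / √t) ^ 2 = 2 * b + (-t - b ^ 2 / t) := by
      rw [← h2, Real.sqrt_sq h0.le]; field_simp; ring
    rw [h1, Real.exp_add, h2]
    field_simp
  · have h0 := Real.sqrt_pos.2 ht
    have h := (Real.hasDerivAt_sqrt ht.ne')
    have h3 := h.sub ((hasDerivAt_const t b).fun_div h h0.ne')
    refine (HasDerivAt.congr_deriv h3 ?_).hasDerivWithinAt
    ring
  · have h0 := Real.sqrt_pos.2 hs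
    have h1 := Real.sqrt_pos.2 ht
    simp only at h
    have h2 : (√s - √t) * (1 + b / (√s * √t)) = 0 := by
      field_simp
      field_simp at h
      linarith
    have h3 : 1 + b / (√s * √t) ≠ 0 := by positivity
    have h4 : √s = √t := by
      have := (mul_eq_zero.1 h2).resolve_right h3
      linarith
    exact (Real.sqrt_inj hs.le ht.le).1 h4

/-- The two summands of `lintegral_add_eq_gaussian` have equal integrals by `lintegral_inv_sqrt_eq`,
so each carries half of the Gaussian integral. -/
lemma lintegral_inv_sqrt {b : ℝ} (hb : 0 < b) :
    ∫⁻ t in Ioi (0 : ℝ), ENNReal.ofReal (Real.exp (-t - b ^ 2 / t) / √t) =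
      ENNReal.ofReal (√Real.pi * Real.exp (-(2 * b))) := by
  have h := lintegral_add_eq_gaussian hb
  have hsplit : ∀ t ∈ Ioi (0 : ℝ), ENNReal.ofReal
        (Real.exp (2 * b) / 2 * (Real.exp (-t - b ^ 2 / t) / √t +
          b * (Real.exp (-t - b ^ 2 / t) / (t * √t)))) =
      ENNReal.ofReal (Real.exp (2 * b) / 2) *
        (ENNReal.ofReal (Real.exp (-t - b ^ 2 / t) / √t) +
          ENNReal.ofReal b * ENNReal.ofReal (Real.exp (-t - b ^ 2 / t) / (t * √t))) :=
    fun t (ht : 0 < t) => by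
      rw [ENNReal.ofReal_mul (by positivity), ENNReal.ofReal_add (by positivity) (by positivity),
        ENNReal.ofReal_mul hb.le]
  rw [setLIntegral_congr_fun measurableSet_Ioi hsplit, lintegral_const_mul' _ _ (by simp),
    lintegral_add_left (by fun_prop), lintegral_const_mul' _ _ (by simp),
    ← lintegral_inv_sqrt_eq hb, ← two_mul, ← mul_assoc, ← ENNReal.ofReal_ofNat,
    ← ENNReal.ofReal_mul (by positivity), div_mul_cancel₀ _ (by norm_num)] at h
  rw [mul_comm √_, ENNReal.ofReal_mul (by positivity), ← h, ← mul_assoc,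
    ← ENNReal.ofReal_mul (by positivity), ← Real.exp_add]
  simp

lemma besselK_half {u : ℝ} (hu : 0 < u) :
    besselK (1 / 2) u = √(Real.pi / (2 * u)) * Real.exp (-u) := by
  have hI : ∫ t in Ioi (0 : ℝ), t ^ (-(1 / 2 : ℝ) - 1) * Real.exp (-t - u ^ 2 / (4 * t)) =
      √Real.pi * Real.exp (-u) / (u / 2) := by
    have h := lintegral_inv_sqrt (half_pos hu)
    rw [lintegral_inv_sqrt_eq (half_pos hu)] at h
    have h1 : ∀ t ∈ Ioi (0 : ℝ), t ^ (-(1 / 2 : ℝ) - 1) * Real.exp (-t - u ^ 2 / (4 * t)) =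
        Real.exp (-t - (u / 2) ^ 2 / t) / (t * √t) := fun t (ht : 0 < t) => by
      rw [Real.rpow_sub ht, Real.rpow_neg ht.le, ← Real.sqrt_eq_rpow, Real.rpow_one,
        show (u / 2) ^ 2 / t = u ^ 2 / (4 * t) by field_simp; ring]
      field_simp
    rw [setIntegral_congr_fun measurableSet_Ioi h1, integral_eq_lintegral_of_nonneg_ae
      ((ae_restrict_iff' measurableSet_Ioi).2 (.of_forall fun t (ht : 0 < t) => by
        simp only [Pi.zero_apply]; positivity))
      (Measurable.aestronglyMeasurable (by fun_prop))]
    have h2 := congrArg ENNReal.toReal h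
    rw [ENNReal.toReal_mul, ENNReal.toReal_ofReal (by positivity),
      ENNReal.toReal_ofReal (by positivity)] at h2
    rw [eq_div_iff (by positivity), mul_comm, h2]
    congr 3
    ring
  rw [besselK, hI, ← Real.sqrt_eq_rpow, Real.sqrt_div hu.le, Real.sqrt_div Real.pi_pos.le,
    Real.sqrt_mul (by norm_num)]
  have h2 : √(2 : ℝ) ^ 2 = 2 := Real.sq_sqrt (by norm_num)
  have h3 := Real.sq_sqrt hu.le
  have h4 := Real.sqrt_pos.2 hu
  field_simp
  rw [h3]

/-! ### The generator in terms of the Laplace and generalized hyperbolic densities. -/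

/-- At `λ = 1/2` the power of `√(δ² + x²) / α` disappears and the numerator has order `0`, while the
factor `exp(-√2 |a|)` of `K_{1/2}(√2 |a|)` in the denominator cancels against the Laplace density.
-/
lemma laplacePDF_mul_ghPDF {a : ℝ} (ha : a ≠ 0) (x : ℝ) :
    laplacePDF a * ghPDF (1 / 2) √2 |a| x = laplaceGen (a ^ 2 + x ^ 2) / Real.pi := by
  have ha' : 0 < |a| := abs_pos.2 ha
  have h2 : √(2 : ℝ) ^ 2 = 2 := Real.sq_sqrt (by norm_num)
  rw [ghPDF, h2, besselK_half (by positivity), laplacePDF, laplaceGen, sub_self, Real.rpow_zero,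
    div_one, sq_abs, ← Real.sqrt_mul (by norm_num), ← Real.sqrt_eq_rpow, Real.sqrt_div (by positivity),
    Real.sqrt_div (by positivity), Real.sqrt_mul (by norm_num), Real.sqrt_mul (by positivity) (|a| * √2),
    Real.sqrt_mul ha'.le, show -(|a| * √2) = -√2 * |a| by ring]
  have hpi := Real.sq_sqrt Real.pi_pos.le
  have h3 := Real.sqrt_pos.2 Real.pi_pos
  have h4 := Real.sqrt_pos.2 ha'
  have h5 : √√(2 : ℝ) ^ 2 = √2 := Real.sq_sqrt (by positivity)
  field_simp
  rw [hpi, h5]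
  ring

/-- By Tonelli, the inner integral in `x` is Gaussian of variance `t`; it turns `t⁻¹` into a
multiple of `1/√t`, leaving `lintegral_inv_sqrt` at `b = |y|/√2`. -/
lemma lintegral_laplaceGen_sq_add {y : ℝ} (hy : y ≠ 0) :
    ∫⁻ x : ℝ, ENNReal.ofReal (laplaceGen (y ^ 2 + x ^ 2)) =
      ENNReal.ofReal (Real.pi * laplacePDF y) := by
  have hy' : 0 < |y| := abs_pos.2 hy
  have h2 : √(2 : ℝ) ^ 2 = 2 := Real.sq_sqrt (by norm_num)
  have hin : ∀ t ∈ Ioi (0 : ℝ),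
      ∫⁻ x : ℝ, ENNReal.ofReal (1 / 2 * (t⁻¹ * Real.exp (-t - (y ^ 2 + x ^ 2) / (2 * t)))) =
        ENNReal.ofReal (√(2 * Real.pi) / 2) *
          ENNReal.ofReal (Real.exp (-t - (|y| / √2) ^ 2 / t) / √t) := fun t (ht : 0 < t) => by
    have heq : ∀ x : ℝ, 1 / 2 * (t⁻¹ * Real.exp (-t - (y ^ 2 + x ^ 2) / (2 * t))) =
        (1 / 2 * t⁻¹ * Real.exp (-t - (|y| / √2) ^ 2 / t)) *
          Real.exp (-(1 / (2 * t)) * x ^ 2) := fun x => by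
      rw [mul_assoc, mul_assoc, ← Real.exp_add, div_pow, h2, sq_abs]
      congr 3
      field_simp
      ring
    simp_rw [heq]
    rw [← ofReal_integral_eq_lintegral_ofReal
      ((integrable_exp_neg_mul_sq (by positivity)).const_mul _) (.of_forall fun x => by
        simp only [Pi.zero_apply]; positivity), integral_const_mul, integral_gaussian,
      ← ENNReal.ofReal_mul (by positivity)]
    congr 1
    rw [show Real.pi / (1 / (2 * t)) = 2 * Real.pi * t by field_simp, Real.sqrt_mul (by positivity)]
    have h3 := Real.sq_sqrt ht.le
    have h4 := Real.sqrt_pos.2 ht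
    field_simp
    rw [h3]
  simp_rw [fun x : ℝ => ofReal_laplaceGen (show 0 < y ^ 2 + x ^ 2 by positivity)]
  rw [lintegral_lintegral_swap (Measurable.aemeasurable (by fun_prop)),
    setLIntegral_congr_fun measurableSet_Ioi hin, lintegral_const_mul' _ _ (by simp),
    lintegral_inv_sqrt (by positivity), ← ENNReal.ofReal_mul (by positivity)]
  congr 1
  rw [laplacePDF, Real.sqrt_mul (by norm_num),
    show -(2 * (|y| / √2)) = -√2 * |y| by field_simp; rw [h2]]
  have hpi := Real.sq_sqrt Real.pi_pos.le
  field_simp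
  rw [hpi, h2]

/-! ### The change of variables `w ↦ w̃`. -/

lemma unitT_pos {w : ℝ} (hw : w ∈ Ioo (0 : ℝ) 1) : 0 < unitT w :=
  neg_pos.2 (Real.log_neg (by linarith [hw.2]) (by linarith [hw.1]))

lemma unitTilde_eq {η σ w : ℝ} (hη : 0 < η) (hw : w ∈ Ioo (0 : ℝ) 1) :
    unitTilde η σ w = 1 / σ * Real.log (unitT w / η) :=
  Real.log_rpow (div_pos (unitT_pos hw) hη) _

lemma hasDerivAt_unitTilde {η σ w : ℝ} (hη : 0 < η) (hw : w ∈ Ioo (0 : ℝ) 1) :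
    HasDerivAt (unitTilde η σ) (1 / ((1 - w) * unitT w * σ)) w := by
  have h1 : (1 - w) ≠ 0 := by linarith [hw.2]
  have ht := unitT_pos hw
  have hT : HasDerivAt unitT (1 / (1 - w)) w := by
    have := (((hasDerivAt_id w).const_sub 1).log h1).neg
    refine this.congr_deriv ?_
    simp [neg_div]
  have hlog := ((hT.div_const η).log (div_pos ht hη).ne').const_mul (1 / σ)
  refine (hlog.congr_of_eventuallyEq ?_).congr_deriv ?_
  · filter_upwards [isOpen_Ioo.mem_nhds hw] with v hv using unitTilde_eq hη hv
  · have := ht.ne'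
    field_simp

lemma injOn_unitTilde {η σ : ℝ} (hη : 0 < η) (hσ : 0 < σ) :
    InjOn (unitTilde η σ) (Ioo 0 1) := by
  intro v hv w hw h
  rw [unitTilde_eq hη hv, unitTilde_eq hη hw] at h
  have h1 := Real.log_injOn_pos (div_pos (unitT_pos hv) hη) (div_pos (unitT_pos hw) hη)
    (mul_left_cancel₀ (by positivity) h)
  have h2 : unitT v = unitT w := (div_left_inj' hη.ne').1 h1
  have h3 := Real.log_injOn_pos (show 0 < 1 - v by linarith [hv.2])
    (show 0 < 1 - w by linarith [hw.2]) (neg_injective h2)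
  linarith

lemma exists_unitTilde_eq {η σ : ℝ} (hη : 0 < η) (hσ : 0 < σ) (v : ℝ) :
    ∃ w ∈ Ioo (0 : ℝ) 1, unitTilde η σ w = v := by
  have hpos : 0 < η * Real.exp (σ * v) := by positivity
  have hw : 1 - Real.exp (-(η * Real.exp (σ * v))) ∈ Ioo (0 : ℝ) 1 :=
    ⟨sub_pos.2 (Real.exp_lt_one_iff.2 (neg_lt_zero.2 hpos)), by
      linarith [Real.exp_pos (-(η * Real.exp (σ * v)))]⟩
  refine ⟨_, hw, ?_⟩
  rw [unitTilde_eq hη hw, unitT, sub_sub_cancel, Real.log_exp, neg_neg, mul_div_cancel_left₀ _ hη.ne',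
    Real.log_exp]
  field_simp

lemma ae_unitTilde_ne_zero {η σ : ℝ} (hη : 0 < η) (hσ : 0 < σ) :
    ∀ᵐ w : ℝ, w ∈ Ioo (0 : ℝ) 1 → unitTilde η σ w ≠ 0 := by
  obtain ⟨w₀, hw₀, h₀⟩ := exists_unitTilde_eq hη hσ 0
  filter_upwards [compl_mem_ae_iff.2 (measure_singleton w₀ : volume {w₀} = 0)] with w hne hw h
  exact hne (injOn_unitTilde hη hσ hw hw₀ (h.trans h₀.symm))

lemma lintegral_image_affine_unitTilde {η σ p q : ℝ} (hη : 0 < η) (hσ : 0 < σ) (hp : 0 < p)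
    {B : Set ℝ} (hB : MeasurableSet B) (hB01 : B ⊆ Ioo (0 : ℝ) 1) (G : ℝ → ℝ≥0∞) :
    ∫⁻ x in (fun w => p * unitTilde η σ w - q) '' B, G x =
      ∫⁻ w in B, ENNReal.ofReal (p * (1 / ((1 - w) * unitT w * σ))) *
        G (p * unitTilde η σ w - q) := by
  rw [lintegral_image_eq_lintegral_abs_deriv_mul
    (f' := fun w => p * (1 / ((1 - w) * unitT w * σ))) hB
    (fun w hw => (((hasDerivAt_unitTilde hη (hB01 hw)).const_mul p).sub_const q).hasDerivWithinAt)
    (fun v hv w hw h => injOn_unitTilde hη hσ (hB01 hv) (hB01 hw)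
      (mul_left_cancel₀ hp.ne' (sub_left_injective h)))]
  refine setLIntegral_congr_fun hB fun w hw => ?_
  have h1 : 0 < 1 - w := by linarith [(hB01 hw).2]
  have h2 := unitT_pos (hB01 hw)
  rw [abs_of_pos (by positivity)]

lemma image_affine_unitTilde {η σ p q : ℝ} (hη : 0 < η) (hσ : 0 < σ) (hp : 0 < p) :
    (fun w => p * unitTilde η σ w - q) '' Ioo 0 1 = univ := by
  refine eq_univ_of_forall fun x => ?_
  obtain ⟨w, hw, h⟩ := exists_unitTilde_eq hη hσ ((x + q) / p)
  refine ⟨w, hw, ?_⟩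
  simp only [h]
  field_simp
  ring

/-! ### Slices of the joint density. -/

lemma one_sub_sq_pos {r : ℝ} (hr : r ∈ Ioo (-1 : ℝ) 1) : 0 < 1 - r ^ 2 := by
  nlinarith [hr.1, hr.2]

lemma quadForm_eq {r : ℝ} (hr : r ∈ Ioo (-1 : ℝ) 1) (a y : ℝ) :
    (a ^ 2 - 2 * r * a * y + y ^ 2) / (1 - r ^ 2) =
      a ^ 2 + (1 / √(1 - r ^ 2) * y - r / √(1 - r ^ 2) * a) ^ 2 := by
  have h := one_sub_sq_pos hr
  have h1 := Real.sq_sqrt h.le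
  have h2 := Real.sqrt_pos.2 h
  rw [← sub_eq_zero]
  have : (1 / √(1 - r ^ 2) * y - r / √(1 - r ^ 2) * a) ^ 2 = (y - r * a) ^ 2 / (1 - r ^ 2) := by
    field_simp; rw [h1]
  rw [this]
  field_simp
  ring

lemma bulsPDF_eq_fst (θ : BULSParams) {w₁ w₂ : ℝ} (h₁ : w₁ ∈ Ioo (0 : ℝ) 1)
    (h₂ : w₂ ∈ Ioo (0 : ℝ) 1) :
    bulsPDF θ laplaceGen (w₁, w₂) =
      1 / ((1 - w₁) * unitT w₁ * θ.σ₁) *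
        ((1 / √(1 - θ.ρ ^ 2) * (1 / ((1 - w₂) * unitT w₂ * θ.σ₂))) *
          (laplaceGen (unitTilde θ.η₁ θ.σ₁ w₁ ^ 2 +
            (1 / √(1 - θ.ρ ^ 2) * unitTilde θ.η₂ θ.σ₂ w₂
              - θ.ρ / √(1 - θ.ρ ^ 2) * unitTilde θ.η₁ θ.σ₁ w₁) ^ 2) / Real.pi)) := by
  rw [bulsPDF, indicator_of_mem (mk_mem_prod h₁ h₂), partitionFn_laplaceGen]
  simp only [quadForm_eq θ.ρ_mem]
  simp only [mul_inv, div_eq_mul_inv]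
  ring

/-- The quadratic form is symmetric, so the square can be completed the other way round; this
version serves to integrate out `w₁`. -/
lemma bulsPDF_eq_snd (θ : BULSParams) {w₁ w₂ : ℝ} (h₁ : w₁ ∈ Ioo (0 : ℝ) 1)
    (h₂ : w₂ ∈ Ioo (0 : ℝ) 1) :
    bulsPDF θ laplaceGen (w₁, w₂) =
      1 / ((1 - w₂) * unitT w₂ * θ.σ₂) / Real.pi *
        ((1 / √(1 - θ.ρ ^ 2) * (1 / ((1 - w₁) * unitT w₁ * θ.σ₁))) *
          laplaceGen (unitTilde θ.η₂ θ.σ₂ w₂ ^ 2 +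
            (1 / √(1 - θ.ρ ^ 2) * unitTilde θ.η₁ θ.σ₁ w₁
              - θ.ρ / √(1 - θ.ρ ^ 2) * unitTilde θ.η₂ θ.σ₂ w₂) ^ 2)) := by
  rw [bulsPDF, indicator_of_mem (mk_mem_prod h₁ h₂), partitionFn_laplaceGen]
  simp only [← quadForm_eq θ.ρ_mem]
  rw [show ∀ a y : ℝ, a ^ 2 - 2 * θ.ρ * a * y + y ^ 2 = y ^ 2 - 2 * θ.ρ * y * a + a ^ 2 by
    intros; ring]
  simp only [mul_inv, div_eq_mul_inv]
  ring

lemma bulsPDF_of_fst_notMem (θ : BULSParams) (g : ℝ → ℝ) {w₁ : ℝ} (h : w₁ ∉ Ioo (0 : ℝ) 1)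
    (w₂ : ℝ) : bulsPDF θ g (w₁, w₂) = 0 :=
  indicator_of_notMem (fun hm => h hm.1) _

lemma measurable_bulsPDF (θ : BULSParams) {g : ℝ → ℝ} (hg : Measurable g) :
    Measurable (bulsPDF θ g) := by
  have hT : Measurable unitT := by unfold unitT; fun_prop
  have h1 : Measurable (unitTilde θ.η₁ θ.σ₁) := by unfold unitTilde; fun_prop
  have h2 : Measurable (unitTilde θ.η₂ θ.σ₂) := by unfold unitTilde; fun_prop
  refine Measurable.indicator ?_ (measurableSet_Ioo.prod measurableSet_Ioo)
  fun_prop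

lemma unitJacobian_pos {σ w : ℝ} (hσ : 0 < σ) (hw : w ∈ Ioo (0 : ℝ) 1) :
    0 < 1 / ((1 - w) * unitT w * σ) := by
  have := unitT_pos hw
  have : 0 < 1 - w := by linarith [hw.2]
  positivity

lemma lintegral_bulsPDF_snd (θ : BULSParams) {B : Set ℝ} (hB : MeasurableSet B)
    (hB01 : B ⊆ Ioo (0 : ℝ) 1) {w₁ : ℝ} (h₁ : w₁ ∈ Ioo (0 : ℝ) 1) :
    ∫⁻ w₂ in B, ENNReal.ofReal (bulsPDF θ laplaceGen (w₁, w₂)) =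
      ENNReal.ofReal (1 / ((1 - w₁) * unitT w₁ * θ.σ₁)) *
        ∫⁻ x in childSet θ B θ.ρ w₁,
          ENNReal.ofReal (laplaceGen (unitTilde θ.η₁ θ.σ₁ w₁ ^ 2 + x ^ 2) / Real.pi) := by
  have hp : 0 < 1 / √(1 - θ.ρ ^ 2) := one_div_pos.2 (Real.sqrt_pos.2 (one_sub_sq_pos θ.ρ_mem))
  rw [childSet, lintegral_image_affine_unitTilde θ.η₂_pos θ.σ₂_pos hp hB hB01,
    ← lintegral_const_mul' _ _ ENNReal.ofReal_ne_top]
  refine setLIntegral_congr_fun hB fun w₂ h₂ => ?_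
  rw [bulsPDF_eq_fst θ h₁ (hB01 h₂), ENNReal.ofReal_mul (unitJacobian_pos θ.σ₁_pos h₁).le,
    ENNReal.ofReal_mul (mul_pos hp (unitJacobian_pos θ.σ₂_pos (hB01 h₂))).le]

lemma lintegral_bulsPDF_fst (θ : BULSParams) {w₂ : ℝ} (h₂ : w₂ ∈ Ioo (0 : ℝ) 1)
    (hy : unitTilde θ.η₂ θ.σ₂ w₂ ≠ 0) :
    ∫⁻ w₁, ENNReal.ofReal (bulsPDF θ laplaceGen (w₁, w₂)) =
      ENNReal.ofReal (1 / ((1 - w₂) * unitT w₂ * θ.σ₂)) *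
        ENNReal.ofReal (laplacePDF (unitTilde θ.η₂ θ.σ₂ w₂)) := by
  have hp : 0 < 1 / √(1 - θ.ρ ^ 2) := one_div_pos.2 (Real.sqrt_pos.2 (one_sub_sq_pos θ.ρ_mem))
  have hJ := unitJacobian_pos θ.σ₂_pos h₂
  have hsupp : ∫⁻ w₁, ENNReal.ofReal (bulsPDF θ laplaceGen (w₁, w₂)) =
      ∫⁻ w₁ in Ioo (0 : ℝ) 1, ENNReal.ofReal (bulsPDF θ laplaceGen (w₁, w₂)) := by
    refine (setLIntegral_eq_of_support_subset ?_).symm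
    intro w hw
    by_contra hn
    exact hw (by simp [bulsPDF_of_fst_notMem θ laplaceGen hn])
  have hCV := lintegral_image_affine_unitTilde (q := θ.ρ / √(1 - θ.ρ ^ 2) * unitTilde θ.η₂ θ.σ₂ w₂)
    θ.η₁_pos θ.σ₁_pos hp measurableSet_Ioo subset_rfl
    fun x => ENNReal.ofReal (laplaceGen (unitTilde θ.η₂ θ.σ₂ w₂ ^ 2 + x ^ 2))
  rw [image_affine_unitTilde θ.η₁_pos θ.σ₁_pos hp, setLIntegral_univ,
    lintegral_laplaceGen_sq_add hy] at hCV
  have hcongr : ∀ w₁ ∈ Ioo (0 : ℝ) 1, ENNReal.ofReal (bulsPDF θ laplaceGen (w₁, w₂)) =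
      ENNReal.ofReal (1 / ((1 - w₂) * unitT w₂ * θ.σ₂) / Real.pi) *
        (ENNReal.ofReal (1 / √(1 - θ.ρ ^ 2) * (1 / ((1 - w₁) * unitT w₁ * θ.σ₁))) *
          ENNReal.ofReal (laplaceGen (unitTilde θ.η₂ θ.σ₂ w₂ ^ 2 +
            (1 / √(1 - θ.ρ ^ 2) * unitTilde θ.η₁ θ.σ₁ w₁
              - θ.ρ / √(1 - θ.ρ ^ 2) * unitTilde θ.η₂ θ.σ₂ w₂) ^ 2))) := fun w₁ h₁ => by
    rw [bulsPDF_eq_snd θ h₁ h₂, ENNReal.ofReal_mul (div_pos hJ Real.pi_pos).le,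
      ENNReal.ofReal_mul (mul_pos hp (unitJacobian_pos θ.σ₁_pos h₁)).le]
  rw [hsupp, setLIntegral_congr_fun measurableSet_Ioo hcongr,
    lintegral_const_mul' _ _ ENNReal.ofReal_ne_top, ← hCV,
    ← ENNReal.ofReal_mul (div_pos hJ Real.pi_pos).le, ← ENNReal.ofReal_mul hJ.le]
  congr 1
  field_simp

lemma childSet_zero (θ : BULSParams) (B : Set ℝ) (w₁ : ℝ) :
    childSet θ B 0 w₁ = (fun w => 1 * unitTilde θ.η₂ θ.σ₂ w - 0) '' B := by
  simp [childSet]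

lemma laplacePDF_nonneg (x : ℝ) : 0 ≤ laplacePDF x := by
  unfold laplacePDF; positivity

lemma measurable_laplacePDF : Measurable laplacePDF := by
  unfold laplacePDF; fun_prop

lemma ghPDF_half_nonneg (δ x : ℝ) (hδ : 0 ≤ δ) : 0 ≤ ghPDF (1 / 2) √2 δ x := by
  have hK : ∀ lam u : ℝ, 0 ≤ u → 0 ≤ besselK lam u := fun lam u hu =>
    mul_nonneg (by positivity)
      (setIntegral_nonneg measurableSet_Ioi fun t (ht : 0 < t) => by positivity)
  have h1 := hK (1 / 2) (δ * √(√2 ^ 2)) (by positivity)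
  have h2 := hK (1 / 2 - 1 / 2) (√2 * √(δ ^ 2 + x ^ 2)) (by positivity)
  unfold ghPDF
  positivity

lemma laplaceCondFormula_nonneg (θ : BULSParams) (B : Set ℝ) {w₁ : ℝ}
    (h₁ : w₁ ∈ Ioo (0 : ℝ) 1) : 0 ≤ laplaceCondFormula θ B w₁ :=
  mul_nonneg (mul_nonneg (unitJacobian_pos θ.σ₁_pos h₁).le (laplacePDF_nonneg _))
    (div_nonneg (integral_nonneg fun _ => ghPDF_half_nonneg _ _ (abs_nonneg _))
      (integral_nonneg laplacePDF_nonneg))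

/-! ### The conditional law. -/

section Law

variable {Ω : Type*} [MeasurableSpace Ω] {P : Measure Ω} {θ : BULSParams} {W : Ω → ℝ × ℝ}

lemma HasRealPDF.map_eq {E : Type*} [MeasureSpace E] {X : Ω → E} {f : E → ℝ}
    (h : HasRealPDF X P f) :
    P.map X = volume.withDensity fun x => ENNReal.ofReal (f x) := by
  have := h.1
  rw [map_eq_withDensity_pdf X P volume]
  exact withDensity_congr_ae h.2.2

lemma IsBULS.measure_rectangle {g : ℝ → ℝ} (hg : Measurable g) (hW : IsBULS W P θ g)
    {S B : Set ℝ} (hS : MeasurableSet S) (hB : MeasurableSet B) :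
    P (W ⁻¹' (S ×ˢ B)) =
      ∫⁻ w₁ in S, ∫⁻ w₂ in B, ENNReal.ofReal (bulsPDF θ g (w₁, w₂)) := by
  have := hW.1
  rw [← Measure.map_apply_of_aemeasurable (HasPDF.aemeasurable W P volume) (hS.prod hB),
    HasRealPDF.map_eq hW, withDensity_apply _ (hS.prod hB), Measure.volume_eq_prod,
    ← Measure.prod_restrict, lintegral_prod]
  exact (measurable_bulsPDF θ hg).ennreal_ofReal.aemeasurable

/-- Integrating out `w₁` leaves the Laplace law for `w̃₂`. At `r = 0` the child set is the image of
`B` under `w̃₂` alone, so `w₁` is a dummy. -/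
lemma IsBULS.measure_snd_mem (hW : IsBULS W P θ laplaceGen) {B : Set ℝ} (hB : MeasurableSet B)
    (hB01 : B ⊆ Ioo (0 : ℝ) 1) (w₁ : ℝ) :
    P {ω | (W ω).2 ∈ B} = ∫⁻ x in childSet θ B 0 w₁, ENNReal.ofReal (laplacePDF x) := by
  have hset : {ω | (W ω).2 ∈ B} = W ⁻¹' (univ ×ˢ B) := by ext; simp
  rw [hset, hW.measure_rectangle measurable_laplaceGen .univ hB, setLIntegral_univ,
    lintegral_lintegral_swap
      (measurable_bulsPDF θ measurable_laplaceGen).ennreal_ofReal.aemeasurable,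
    childSet_zero, lintegral_image_affine_unitTilde θ.η₂_pos θ.σ₂_pos one_pos hB hB01]
  refine setLIntegral_congr_fun_ae hB ?_
  -- The marginal formula requires `w̃₂ ≠ 0`, which fails only at one point.
  filter_upwards [ae_unitTilde_ne_zero θ.η₂_pos θ.σ₂_pos] with w₂ hne h₂
  rw [lintegral_bulsPDF_fst θ (hB01 h₂) (hne (hB01 h₂)), one_mul, one_mul, sub_zero]

lemma IsBULS.measureReal_snd_mem (hW : IsBULS W P θ laplaceGen) {B : Set ℝ}
    (hB : MeasurableSet B) (hB01 : B ⊆ Ioo (0 : ℝ) 1) (w₁ : ℝ) :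
    P.real {ω | (W ω).2 ∈ B} = laplaceF (childSet θ B 0 w₁) := by
  rw [Measure.real, hW.measure_snd_mem hB hB01 w₁, laplaceF,
    integral_eq_lintegral_of_nonneg_ae (.of_forall laplacePDF_nonneg)
      measurable_laplacePDF.aestronglyMeasurable]

lemma lintegral_bulsPDF_snd_lt_top (θ : BULSParams) {B : Set ℝ} (hB : MeasurableSet B)
    (hB01 : B ⊆ Ioo (0 : ℝ) 1) {w₁ : ℝ} (h₁ : w₁ ∈ Ioo (0 : ℝ) 1)
    (ha : unitTilde θ.η₁ θ.σ₁ w₁ ≠ 0) :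
    ∫⁻ w₂ in B, ENNReal.ofReal (bulsPDF θ laplaceGen (w₁, w₂)) < ∞ := by
  rw [lintegral_bulsPDF_snd θ hB hB01 h₁]
  -- Enlarging the child set to the whole line makes the integral explicit.
  refine ENNReal.mul_lt_top ENNReal.ofReal_lt_top ((setLIntegral_le_lintegral _ _).trans_lt ?_)
  simp_rw [div_eq_mul_inv, fun x : ℝ => ENNReal.ofReal_mul (q := Real.pi⁻¹)
    (laplaceGen_nonneg (unitTilde θ.η₁ θ.σ₁ w₁ ^ 2 + x ^ 2))]
  rw [lintegral_mul_const' _ _ ENNReal.ofReal_ne_top, lintegral_laplaceGen_sq_add ha]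
  exact ENNReal.mul_lt_top ENNReal.ofReal_lt_top ENNReal.ofReal_lt_top

lemma bulsPDF_laplaceGen_nonneg (θ : BULSParams) {w₁ w₂ : ℝ} (h₁ : w₁ ∈ Ioo (0 : ℝ) 1)
    (h₂ : w₂ ∈ Ioo (0 : ℝ) 1) : 0 ≤ bulsPDF θ laplaceGen (w₁, w₂) := by
  rw [bulsPDF_eq_fst θ h₁ h₂]
  exact mul_nonneg (unitJacobian_pos θ.σ₁_pos h₁).le (mul_nonneg (mul_nonneg (by positivity)
    (unitJacobian_pos θ.σ₂_pos h₂).le) (div_nonneg (laplaceGen_nonneg _) Real.pi_pos.le))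

lemma integrableOn_bulsPDF_snd (θ : BULSParams) {B : Set ℝ} (hB : MeasurableSet B)
    (hB01 : B ⊆ Ioo (0 : ℝ) 1) {w₁ : ℝ} (h₁ : w₁ ∈ Ioo (0 : ℝ) 1)
    (ha : unitTilde θ.η₁ θ.σ₁ w₁ ≠ 0) :
    IntegrableOn (fun w₂ => bulsPDF θ laplaceGen (w₁, w₂)) B := by
  refine ⟨((measurable_bulsPDF θ measurable_laplaceGen).comp
    measurable_prodMk_left).aestronglyMeasurable, ?_⟩
  rw [hasFiniteIntegral_iff_ofReal ((ae_restrict_iff' hB).2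
    (.of_forall fun w₂ h₂ => bulsPDF_laplaceGen_nonneg θ h₁ (hB01 h₂)))]
  exact lintegral_bulsPDF_snd_lt_top θ hB hB01 h₁ ha

lemma integral_bulsPDF_snd (θ : BULSParams) {B : Set ℝ} (hB : MeasurableSet B)
    (hB01 : B ⊆ Ioo (0 : ℝ) 1) {w₁ : ℝ} (h₁ : w₁ ∈ Ioo (0 : ℝ) 1)
    (ha : unitTilde θ.η₁ θ.σ₁ w₁ ≠ 0) :
    ∫ w₂ in B, bulsPDF θ laplaceGen (w₁, w₂) =
      1 / ((1 - w₁) * unitT w₁ * θ.σ₁) * (laplacePDF (unitTilde θ.η₁ θ.σ₁ w₁) *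
        ghF (childSet θ B θ.ρ w₁) (1 / 2) √2 |unitTilde θ.η₁ θ.σ₁ w₁|) := by
  rw [integral_eq_lintegral_of_nonneg_ae ((ae_restrict_iff' hB).2
      (.of_forall fun w₂ h₂ => bulsPDF_laplaceGen_nonneg θ h₁ (hB01 h₂)))
      ((measurable_bulsPDF θ measurable_laplaceGen).comp
        measurable_prodMk_left).aestronglyMeasurable,
    lintegral_bulsPDF_snd θ hB hB01 h₁, ENNReal.toReal_mul,
    ENNReal.toReal_ofReal (unitJacobian_pos θ.σ₁_pos h₁).le, ghF, ← integral_const_mul]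
  simp_rw [laplacePDF_mul_ghPDF ha]
  rw [integral_eq_lintegral_of_nonneg_ae
    (.of_forall fun x => div_nonneg (laplaceGen_nonneg _) Real.pi_pos.le)]
  have := measurable_laplaceGen
  exact Measurable.aestronglyMeasurable (by fun_prop)

lemma IsBULS.integral_div_eq_laplaceCondFormula (hW : IsBULS W P θ laplaceGen) {B : Set ℝ}
    (hB : MeasurableSet B) (hB01 : B ⊆ Ioo (0 : ℝ) 1) {w₁ : ℝ} (h₁ : w₁ ∈ Ioo (0 : ℝ) 1)
    (ha : unitTilde θ.η₁ θ.σ₁ w₁ ≠ 0) :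
    (∫ w₂ in B, bulsPDF θ laplaceGen (w₁, w₂)) / P.real {ω | (W ω).2 ∈ B} =
      laplaceCondFormula θ B w₁ := by
  rw [integral_bulsPDF_snd θ hB hB01 h₁ ha, hW.measureReal_snd_mem hB hB01 w₁,
    laplaceCondFormula]
  ring

lemma IsBULS.map_fst_cond {g : ℝ → ℝ} (hg : Measurable g) (hW : IsBULS W P θ g) {B : Set ℝ}
    (hB : MeasurableSet B) :
    (cond P {ω | (W ω).2 ∈ B}).map (fun ω => (W ω).1) = volume.withDensity fun w₁ =>
      (P {ω | (W ω).2 ∈ B})⁻¹ * ∫⁻ w₂ in B, ENNReal.ofReal (bulsPDF θ g (w₁, w₂)) := by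
  have := hW.1
  have hm : AEMeasurable W P := HasPDF.aemeasurable W P volume
  -- `W` is only a.e. measurable, so the conditioning event is only null measurable.
  have hA : NullMeasurableSet {ω | (W ω).2 ∈ B} P :=
    (measurable_snd.comp_aemeasurable hm).nullMeasurableSet_preimage hB
  have hm' : AEMeasurable (fun ω => (W ω).1) (cond P {ω | (W ω).2 ∈ B}) :=
    (measurable_fst.comp_aemeasurable hm).mono_ac cond_absolutelyContinuous
  have hint : Measurable fun w₁ => ∫⁻ w₂ in B, ENNReal.ofReal (bulsPDF θ g (w₁, w₂)) :=
    (measurable_bulsPDF θ hg).ennreal_ofReal.lintegral_prod_right'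
  ext S hS
  rw [Measure.map_apply_of_aemeasurable hm' hS, withDensity_apply _ hS, lintegral_const_mul _ hint,
    ← hW.measure_rectangle hg hS hB, ProbabilityTheory.cond, Measure.smul_apply, Measure.restrict_apply₀' hA,
    smul_eq_mul]
  rfl

lemma IsBULS.hasRealPDF_fst_cond [IsProbabilityMeasure P] (hW : IsBULS W P θ laplaceGen)
    {B : Set ℝ} (hB : MeasurableSet B) (hB01 : B ⊆ Ioo (0 : ℝ) 1)
    (hPB : 0 < P {ω | (W ω).2 ∈ B}) :
    HasRealPDF (fun ω => (W ω).1) (cond P {ω | (W ω).2 ∈ B})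
      ((Ioo (0 : ℝ) 1).indicator (laplaceCondFormula θ B)) := by
  have := hW.1
  have hm : AEMeasurable W P := HasPDF.aemeasurable W P volume
  have hm' : AEMeasurable (fun ω => (W ω).1) (cond P {ω | (W ω).2 ∈ B}) :=
    (measurable_fst.comp_aemeasurable hm).mono_ac cond_absolutelyContinuous
  have hint : Measurable fun w₁ => (P {ω | (W ω).2 ∈ B})⁻¹ *
      ∫⁻ w₂ in B, ENNReal.ofReal (bulsPDF θ laplaceGen (w₁, w₂)) :=
    (measurable_bulsPDF θ measurable_laplaceGen).ennreal_ofReal.lintegral_prod_right'.const_mul _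
  have hmap := hW.map_fst_cond measurable_laplaceGen hB
  have hpdf : HasPDF (fun ω => (W ω).1) (cond P {ω | (W ω).2 ∈ B}) volume :=
    hasPDF_of_map_eq_withDensity hm' _ hint.aemeasurable hmap
  refine ⟨hpdf, fun w => indicator_nonneg (fun w hw => laplaceCondFormula_nonneg θ B hw) w,
    ((pdf.eq_of_map_eq_withDensity' _ hint.aemeasurable).1 hmap).trans ?_⟩
  -- The point with `w̃₁ = 0` is null, so the value of the formula there does not affect the
  -- density.
  filter_upwards [ae_unitTilde_ne_zero θ.η₁_pos θ.σ₁_pos] with w₁ hne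
  by_cases h₁ : w₁ ∈ Ioo (0 : ℝ) 1
  · have hfin := integrableOn_bulsPDF_snd θ hB hB01 h₁ (hne h₁)
    have hpos : 0 < P.real {ω | (W ω).2 ∈ B} := ENNReal.toReal_pos hPB.ne' (measure_ne_top _ _)
    rw [indicator_of_mem h₁, ← hW.integral_div_eq_laplaceCondFormula hB hB01 h₁ (hne h₁),
      ENNReal.ofReal_div_of_pos hpos, ofReal_integral_eq_lintegral_ofReal hfin
        ((ae_restrict_iff' hB).2
          (.of_forall fun w₂ h₂ => bulsPDF_laplaceGen_nonneg θ h₁ (hB01 h₂))),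
      ofReal_measureReal, mul_comm, div_eq_mul_inv]
  · simp [indicator_of_notMem h₁, bulsPDF_of_fst_notMem θ laplaceGen h₁]

end Law

/-- The first part says that the expression, extended by `0` outside `(0, 1)`, is a density of the
conditional law of `W₁` given `W₂ ∈ B`. The second says that it agrees with the canonical version
`(∫_B f(w₁, w₂) dw₂) / P(W₂ ∈ B)` of this density at every point at which the generalized
hyperbolic law has a positive scale parameter `|w̃₁|`, that is, at every `w₁ ≠ 1 - exp (-η₁)`. -/
theorem mainTheorem7 {Ω : Type*} [MeasurableSpace Ω] (P : Measure Ω) [IsProbabilityMeasure P]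
    (θ : BULSParams) (W : Ω → ℝ × ℝ) (hW : IsBULS W P θ laplaceGen)
    (B : Set ℝ) (hB : MeasurableSet B) (hB01 : B ⊆ Ioo (0 : ℝ) 1)
    (hPB : 0 < P {ω | (W ω).2 ∈ B}) :
    HasRealPDF (fun ω => (W ω).1) (cond P {ω | (W ω).2 ∈ B})
        ((Ioo (0 : ℝ) 1).indicator (laplaceCondFormula θ B)) ∧
      ∀ w₁ ∈ Ioo (0 : ℝ) 1, unitTilde θ.η₁ θ.σ₁ w₁ ≠ 0 →
        IntegrableOn (fun w₂ => bulsPDF θ laplaceGen (w₁, w₂)) B ∧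
        (∫ w₂ in B, bulsPDF θ laplaceGen (w₁, w₂)) / P.real {ω | (W ω).2 ∈ B} =
          laplaceCondFormula θ B w₁ :=
  ⟨hW.hasRealPDF_fst_cond hB hB01 hPB, fun _ h₁ ha =>
    ⟨integrableOn_bulsPDF_snd θ hB hB01 h₁ ha,
      hW.integral_div_eq_laplaceCondFormula hB hB01 h₁ ha⟩⟩
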